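/- Setting. Let $F:[0,1]^n\to\mathbb{R}_{\ge 0}$ be DR-submodular (not necessarily monotone), i.e. $F(\mathbf{x}+k\mathbf{e}_i)-F(\mathbf{x})\ge F(\mathbf{y}+k\mathbf{e}_i)-F(\mathbf{y})$ for all $\mathbf{x}\le\mathbf{y}$, all $i$ and all $k\ge 0$ for which these points lie in $[0,1]^n$, and $L$-smooth, i.e. differentiable on $[0,1]^n$ with an $L$-Lipschitz gradient ($L\ge 0$, Euclidean norm). Let $\mathcal{P}\subseteq[0,1]^n$ be nonempty, closed, convex and down-closed ($\mathbf{x}\in\mathcal{P}$ and $\mathbf{0}\le\mathbf{z}\le\mathbf{x}$ imply $\mathbf{z}\in\mathcal{P}$), and let $D=\max_{\mathbf{x},\mathbf{y}\in\mathcal{P}}\|\mathbf{x}-\mathbf{y}\|^2$. Let $\varepsilon>0$, let $\theta$ satisfy $|\theta-0.372|\le 0.0005$, and put $$p=\frac{e}{e+e^{\theta}(3-\theta)-3}.$$ Algorithm. Let $N_1,N_2$ be natural numbers with $N=N_1+N_2\ge 1$ and $|N_1-\theta N|\le 1$. (1) Take a stationary point $\mathbf{y}\in\mathcal{P}$ with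 gap at most $\varepsilon$, i.e. $\max_{\mathbf{z}\in\mathcal{P}}\langle\nabla F(\mathbf{y}),\mathbf{z}-\mathbf{y}\rangle\le\varepsilon$ (in particular, any exact stationary point, for which this maximum is at most $0$). (2) Draw a random set $A\subseteq[n]$ that contains each $i$ independently with probability $y_i$; let $\hat A=[n]\setminus A$. (3) Start from $\mathbf{x}_0=\mathbf{0}$. For $j=0,\dots,N-1$: if $j<N_1$, let $\mathbf{v}_j$ be any maximizer of $\langle\nabla F(\mathbf{x}_j),\mathbf{v}\rangle$ over $\mathbf{v}\in\mathcal{P}$ with $\mathbf{v}\le(\mathbf{1}-\mathbf{x}_j)\odot\mathbf{1}_{\hat A}$, and put $\mathbf{x}_{j+1}=\mathbf{x}_j+(1-e^{-1/N})\mathbf{v}_j$; if $j\ge N_1$, let $\mathbf{v}_j$ be any maximizer of $\langle\nabla F(\mathbf{x}_j),\mathbf{v}\rangle$ over $\mathbf{v}\in\mathcal{P}$ with $\mathbf{v}\le\mathbf{1}-\mathbf{x}_j$, and put $\mathbf{x}_{j+1}=\mathbf{x}_j+\frac{1}{Ne^{1/N}}\mathbf{v}_j$. (4) Output $\mathbf{x}(1):=\mathbf{x}_N$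 with probability $p$ and $\mathbf{y}$ with probability $1-p$. Theorem. One has $|p-0.77|\le 0.0005$, and there is an absolute constant $C>0$ such that, for all data as above, $N\ge C\max\{1,DL/\varepsilon\}$ iterations of the loop in (3) suffice for the following: the output always lies in $\mathcal{P}$, and its expected value satisfies $$\mathbb{E}[F(\text{output})]=\mathbb{E}_A\big[p\,F(\mathbf{x}(1))+(1-p)F(\mathbf{y})\big]>0.385\cdot\max_{\mathbf{x}\in\mathcal{P}}F(\mathbf{x})-\varepsilon .$$ Hence the two-phase stage gives a $0.385$-approximation up to additive error $\varepsilon$ with $O(DL/\varepsilon)$ iterations. -/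

import Mathlib

noncomputable section

namespace AidedFW

/-- Euclidean space `ℝⁿ`. -/
abbrev E (n : ℕ) : Type := EuclideanSpace ℝ (Fin n)

/-- The box `[0,1]ⁿ`, on which objective functions are defined. -/
def cube (n : ℕ) : Set (E n) := {x | ∀ i, 0 ≤ x i ∧ x i ≤ 1}

/-- The gradient of `F` on the box `[0,1]ⁿ` (one-sided at the boundary of the box). -/
def grad {n : ℕ} (F : E n → ℝ) (x : E n) : E n := gradientWithin F (cube n) x

/-- `F` is `L`-smooth on the box: it is differentiable with an `L`-Lipschitz gradient. -/
def IsLSmooth {n : ℕ} (F : E n → ℝ) (L : ℝ) : Prop :=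
  DifferentiableOn ℝ F (cube n) ∧
    ∀ x ∈ cube n, ∀ y ∈ cube n, ‖grad F x - grad F y‖ ≤ L * ‖x - y‖

/-- DR-submodularity on the box: diminishing returns along every coordinate. -/
def IsDRSubmodular {n : ℕ} (F : E n → ℝ) : Prop :=
  ∀ x ∈ cube n, ∀ y ∈ cube n, (∀ i, x i ≤ y i) →
    ∀ (i : Fin n) (k : ℝ), 0 ≤ k →
      x + EuclideanSpace.single i k ∈ cube n → y + EuclideanSpace.single i k ∈ cube n →
      F (y + EuclideanSpace.single i k) - F y ≤ F (x + EuclideanSpace.single i k) - F x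

/-- Down-closedness inside the non-negative orthant. -/
def IsDownClosed {n : ℕ} (P : Set (E n)) : Prop :=
  ∀ x ∈ P, ∀ z : E n, (∀ i, 0 ≤ z i ∧ z i ≤ x i) → z ∈ P

/-- A feasible domain: a nonempty, closed, convex, down-closed subset of the box. -/
structure IsFeasibleDomain {n : ℕ} (P : Set (E n)) : Prop where
  nonempty : P.Nonempty
  subset_cube : P ⊆ cube n
  closed : IsClosed P
  convex : Convex ℝ P
  downClosed : IsDownClosed P

/-- The optimal value `max_{x ∈ P} F x`. -/
def optValue {n : ℕ} (F : E n → ℝ) (P : Set (E n)) : ℝ := sSup (F '' P)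

/-- `D = max_{x, y ∈ P} ‖x - y‖²`. -/
def sqDiam {n : ℕ} (P : Set (E n)) : ℝ := Metric.diam P ^ 2

/-- `y` is a stationary point of `max_{x ∈ P} F x` with gap at most `δ`:
`y ∈ P` and `max_{z ∈ P} ⟨∇F(y), z - y⟩ ≤ δ`. An (exact) stationary point is the case `δ = 0`. -/
def IsStationaryWithGap {n : ℕ} (F : E n → ℝ) (P : Set (E n)) (δ : ℝ) (y : E n) : Prop :=
  y ∈ P ∧ ∀ z ∈ P, inner ℝ (grad F y) (z - y) ≤ δ

/-- `v` maximizes the linear function `⟨g, ·⟩` over `{v ∈ P : v ≤ u}`. -/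
def IsLinearArgmax {n : ℕ} (P : Set (E n)) (u : Fin n → ℝ) (g v : E n) : Prop :=
  (v ∈ P ∧ ∀ i, v i ≤ u i) ∧ ∀ w ∈ P, (∀ i, w i ≤ u i) → inner ℝ g w ≤ inner ℝ g v

/-- The upper bound on the direction in iteration `j` at the point `x`: `(1 - x) ⊙ 1_Â` in the first
phase (`j < N₁`), where `Â` is the complement of `A`, and `1 - x` in the second phase. -/
def directionBound {n : ℕ} (A : Finset (Fin n)) (N₁ j : ℕ) (x : E n) (i : Fin n) : ℝ :=
  if j < N₁ ∧ i ∈ A then 0 else 1 - x i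

/-- The step size in iteration `j`: `1 - e^{-1/(N₁+N₂)}` in the first phase and
`1 / ((N₁+N₂) e^{1/(N₁+N₂)})` in the second one. -/
def stepSize (N₁ N₂ j : ℕ) : ℝ :=
  if j < N₁ then 1 - Real.exp (-1 / ((N₁ : ℝ) + N₂))
  else 1 / (((N₁ : ℝ) + N₂) * Real.exp (1 / ((N₁ : ℝ) + N₂)))

/-- `x 0, x 1, …, x (N₁ + N₂)` are the iterates of one execution of the two-phase Frank-Wolfe variant
for the set `A` (ties between maximizers may be broken in any way); `x j` is the point at time
`j / (N₁ + N₂)`. -/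
def IsRun {n : ℕ} (F : E n → ℝ) (P : Set (E n)) (A : Finset (Fin n)) (N₁ N₂ : ℕ)
    (x : ℕ → E n) : Prop :=
  x 0 = 0 ∧ ∀ j < N₁ + N₂, ∃ v : E n,
    IsLinearArgmax P (directionBound A N₁ j (x j)) (grad F (x j)) v ∧
      x (j + 1) = x j + stepSize N₁ N₂ j • v

/-- The probability of drawing `A` when each `i` is included independently with probability `y i`. -/
def drawProb {n : ℕ} (y : E n) (A : Finset (Fin n)) : ℝ :=
  (∏ i ∈ A, y i) * ∏ i ∈ Aᶜ, (1 - y i)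

/-- The probability with which the last iterate `x(1)` is returned. -/
def outProb (θ : ℝ) : ℝ :=
  Real.exp 1 / (Real.exp 1 + Real.exp θ * (3 - θ) - 3)

/-- The expected objective value of the output: draw `A` from `y`, then return the last iterate
`xlast A` of the run for `A` with probability `p` and `y` with probability `1 - p`. -/
def expectedOutput {n : ℕ} (F : E n → ℝ) (p : ℝ) (y : E n) (xlast : Finset (Fin n) → E n) : ℝ :=
  ∑ A : Finset (Fin n), drawProb y A * (p * F (xlast A) + (1 - p) * F y)

end AidedFW

end

/-!
Write `o` for a maximizer of `F` over `P`, `a ⊕ b = a + (1 - a) ⊙ b` for the probabilistic sum,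
`N = N₁ + N₂`, `q = e^{-1/N}` and `τ = N₁ / N`.

A differentiable DR-submodular function is concave along non-negative directions
(`IsDRSubmodular.concaveOn_line`). Everything about `F` follows from this and from diminishing
returns for vector increments (`IsDRSubmodular.sub_le_sub`).

*The stationary point.* The increments from `y` to `o ⊙ y` and to `o ⊕ y` are of constant sign and
add up to `o - y`, so that `F(y) ≥ F(o ⊙ y) - ε` and `2 F(y) ≥ F(o ⊙ y) + F(o ⊕ y) - ε`
(`IsStationaryWithGap.sub_le`, `IsStationaryWithGap.add_sub_le`).

*A single run.* Smoothness compares a step with the feasible direction `(1 - x_j) ⊙ o'`, where `o'`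
is `o` with the coordinates in `A` set to zero in the first phase, and `o` in the second
(`IsRun.step_gain`). As `1 - x_j ≥ q ^ j`, and `x_j` vanishes on `A` during the first phase,
`F(x_j ⊕ o') ≥ F(o') - (1 - q ^ j) F(o ⊕ 1_A)` there; after `k` steps of the second phase
`F(x_{N₁ + k} ⊕ o) ≥ q ^ k (F(o) - (1 - q ^ N₁) F(o ⊕ 1_A))`. Solving the two linear recursions, and
using `F(o') ≥ F(o) - F(o ⊙ 1_A)`, gives (`IsRun.last_ge`)
`F(x_N) ≥ e^{τ-1} ((2-τ-e^{-τ}) F(o) - (1-e^{-τ}) F(o ⊙ 1_A) - (2-τ-2e^{-τ}) F(o ⊕ 1_A)) - D L / N`.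

*Averaging over `A`.* Concavity in each coordinate shows that the averages of `F(o ⊙ 1_A)` and
`F(o ⊕ 1_A)` are at most `F(o ⊙ y)` and `F(o ⊕ y)` (`IsDRSubmodular.sum_drawProb_le`). The
probability `p` is chosen so that, for `τ = θ`, the weight `1 - p` of `F(y)` exactly pays for both
negative terms; what remains is `p e^{τ-1} (2-τ-e^{-τ}) > 0.385` times `F(o)`. The numerical slack
absorbs `|τ - θ| ≤ 1 / N`, and `D L / N` is a small multiple of `ε` (`combine_bounds`).
-/

namespace AidedFW

variable {n : ℕ} {F : E n → ℝ} {P : Set (E n)}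

/-! ### Vectors and the box -/

/-- The restriction `d ⊙ 1_S` of a vector to a set of coordinates. -/
noncomputable def restrict (d : E n) (S : Finset (Fin n)) : E n :=
  WithLp.toLp 2 fun i => if i ∈ S then d i else 0

/-- The coordinatewise product `x ⊙ y`. -/
noncomputable def hadamard (x y : E n) : E n := WithLp.toLp 2 fun i => x i * y i

/-- The slack `1 - x` of a point of the box. Adding `(1 - x) ⊙ y` to `x` gives the probabilistic
sum of `x` and `y`. -/
noncomputable def slack (x : E n) : E n := WithLp.toLp 2 fun i => 1 - x i

@[simp] theorem restrict_apply (d : E n) (S : Finset (Fin n)) (i : Fin n) :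
    restrict d S i = if i ∈ S then d i else 0 := rfl

@[simp] theorem hadamard_apply (x y : E n) (i : Fin n) : hadamard x y i = x i * y i := rfl

@[simp] theorem slack_apply (x : E n) (i : Fin n) : slack x i = 1 - x i := rfl

theorem restrict_empty (d : E n) : restrict d ∅ = 0 := by
  ext i; simp

theorem restrict_univ (d : E n) : restrict d Finset.univ = d := by
  ext i; simp

theorem restrict_insert (d : E n) {S : Finset (Fin n)} {i : Fin n} (hi : i ∉ S) :
    restrict d (insert i S) = restrict d S + EuclideanSpace.single i (d i) := by
  ext k
  by_cases hk : k = i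
  · subst hk; simp [hi]
  · simp [hk, Finset.mem_insert]

theorem convex_cube : Convex ℝ (cube n) := by
  intro x hx y hy a b ha hb hab i
  have h1 := hx i
  have h2 := hy i
  simp only [PiLp.add_apply, PiLp.smul_apply, smul_eq_mul]
  constructor
  · nlinarith [mul_nonneg ha h1.1, mul_nonneg hb h2.1]
  · nlinarith [mul_le_mul_of_nonneg_left h1.2 ha, mul_le_mul_of_nonneg_left h2.2 hb]

theorem add_smul_mem_cube {x d : E n} (hx : x ∈ cube n) (hxd : x + d ∈ cube n) {t : ℝ}
    (ht : t ∈ Set.Icc (0 : ℝ) 1) : x + t • d ∈ cube n :=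
  convex_cube.add_smul_mem hx hxd ht

/-- A point between two points of the box lies in the box. -/
theorem mem_cube_of_le {x y z : E n} (hx : x ∈ cube n) (hz : z ∈ cube n)
    (hxy : ∀ i, x i ≤ y i) (hyz : ∀ i, y i ≤ z i) : y ∈ cube n :=
  fun i => ⟨(hx i).1.trans (hxy i), (hyz i).trans (hz i).2⟩

/-! ### Diminishing returns and concavity along non-negative directions -/

/-- Diminishing returns for an arbitrary non-negative increment, by adding its coordinates one
at a time. -/
theorem IsDRSubmodular.sub_le_sub (hF : IsDRSubmodular F) {x y d : E n} (hx : x ∈ cube n)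
    (hyd : y + d ∈ cube n) (hxy : ∀ i, x i ≤ y i) (hd : ∀ i, 0 ≤ d i) :
    F (y + d) - F y ≤ F (x + d) - F x := by
  have hle : ∀ (S : Finset (Fin n)) i, 0 ≤ restrict d S i ∧ restrict d S i ≤ d i := by
    intro S i
    rw [restrict_apply]
    split_ifs
    · exact ⟨hd i, le_rfl⟩
    · exact ⟨le_rfl, hd i⟩
  have hyS : ∀ S, y + restrict d S ∈ cube n := fun S i => by
    have h1 := hle S i; have h2 := hyd i; have h3 := hx i; have h4 := hxy i
    simp only [PiLp.add_apply] at h2 ⊢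
    constructor <;> linarith
  have hxS : ∀ S, x + restrict d S ∈ cube n := fun S i => by
    have h1 := hle S i; have h2 := hyS S i; have h3 := hx i; have h4 := hxy i
    simp only [PiLp.add_apply] at h2 ⊢
    constructor <;> linarith
  have key : ∀ S : Finset (Fin n),
      F (y + restrict d S) - F y ≤ F (x + restrict d S) - F x := by
    intro S
    induction S using Finset.induction_on with
    | empty => simp [restrict_empty]
    | insert i S hi ih =>
      have h := hF (x + restrict d S) (hxS S) (y + restrict d S) (hyS S)
        (fun k => by simpa using hxy k) i (d i) (hd i)
        (by rw [add_assoc, ← restrict_insert d hi]; exact hxS _)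
        (by rw [add_assoc, ← restrict_insert d hi]; exact hyS _)
      rw [restrict_insert d hi, ← add_assoc, ← add_assoc]
      linarith
  simpa [restrict_univ] using key Finset.univ

theorem hasDerivWithinAt_line (hF : DifferentiableOn ℝ F (cube n)) {x d : E n}
    (hx : x ∈ cube n) (hxd : x + d ∈ cube n) {t : ℝ} (ht : t ∈ Set.Icc (0 : ℝ) 1) :
    HasDerivWithinAt (fun s : ℝ => F (x + s • d)) (inner ℝ (grad F (x + t • d)) d)
      (Set.Icc 0 1) t := by
  have h1 : HasFDerivWithinAt F _ (cube n) (x + t • d) :=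
    (hF _ (add_smul_mem_cube hx hxd ht)).hasGradientWithinAt.hasFDerivWithinAt
  have h2 : HasDerivWithinAt (fun s : ℝ => x + s • d) d (Set.Icc 0 1) t := by
    simpa using (((hasDerivAt_id t).smul_const d).const_add x).hasDerivWithinAt
  have h3 := h1.comp_hasDerivWithinAt t h2 fun s hs => add_smul_mem_cube hx hxd hs
  exact h3.congr_deriv (by simp [grad])

/-- Along a non-negative direction the derivative of a DR-submodular function decreases, because
its increments over a fixed step do. -/
theorem IsDRSubmodular.concaveOn_line (hDR : IsDRSubmodular F)
    (hF : DifferentiableOn ℝ F (cube n)) {x d : E n} (hx : x ∈ cube n) (hxd : x + d ∈ cube n)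
    (hd : ∀ i, 0 ≤ d i) : ConcaveOn ℝ (Set.Icc 0 1) (fun s : ℝ => F (x + s • d)) := by
  have hder : ∀ t ∈ Set.Ioo (0 : ℝ) 1, HasDerivAt (fun s : ℝ => F (x + s • d))
      (inner ℝ (grad F (x + t • d)) d) t := fun t ht =>
    (hasDerivWithinAt_line hF hx hxd (Set.Ioo_subset_Icc_self ht)).hasDerivAt
      (Icc_mem_nhds ht.1 ht.2)
  refine AntitoneOn.concaveOn_of_deriv (convex_Icc 0 1)
    (fun t ht => (hasDerivWithinAt_line hF hx hxd ht).continuousWithinAt) ?_ ?_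
  · rw [interior_Icc]
    exact fun t ht => (hder t ht).differentiableAt.differentiableWithinAt
  · rw [interior_Icc]
    intro s hs t ht hst
    have hs' := (hder s hs).tendsto_slope_zero_right
    have ht' := (hder t ht).tendsto_slope_zero_right
    rw [(hder s hs).deriv, (hder t ht).deriv]
    refine le_of_tendsto_of_tendsto ht' hs' ?_
    have hpos : ∀ᶠ h : ℝ in nhdsWithin 0 (Set.Ioi 0), h ∈ Set.Ioo 0 (1 - t) :=
      Ioo_mem_nhdsGT (by linarith [ht.2])
    filter_upwards [hpos] with h hh
    have hk : F (x + t • d + h • d) - F (x + t • d) ≤ F (x + s • d + h • d) - F (x + s • d) := by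
      refine hDR.sub_le_sub (add_smul_mem_cube hx hxd ⟨hs.1.le, hs.2.le⟩) ?_ ?_ ?_
      · rw [add_assoc, ← add_smul]
        exact add_smul_mem_cube hx hxd ⟨by linarith [ht.1, hh.1], by linarith [hh.2]⟩
      · intro i
        have := mul_le_mul_of_nonneg_right hst (hd i)
        simpa using this
      · intro i
        have := mul_nonneg hh.1.le (hd i)
        simpa using this
    simp only [smul_eq_mul, add_smul, ← add_assoc]
    exact mul_le_mul_of_nonneg_left hk (inv_nonneg.2 hh.1.le)

theorem IsDRSubmodular.sub_le_inner (hDR : IsDRSubmodular F)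
    (hF : DifferentiableOn ℝ F (cube n)) {x d : E n} (hx : x ∈ cube n) (hxd : x + d ∈ cube n)
    (hd : ∀ i, 0 ≤ d i) : F (x + d) - F x ≤ inner ℝ (grad F x) d := by
  have hc := hDR.concaveOn_line hF hx hxd hd
  have h := hc.slope_le_of_hasDerivWithinAt (x := 0) (y := 1) (by simp) (by simp) one_pos
    (hasDerivWithinAt_line hF hx hxd (by simp))
  simpa [slope_def_field] using h

theorem IsDRSubmodular.inner_le_sub (hDR : IsDRSubmodular F)
    (hF : DifferentiableOn ℝ F (cube n)) {x d : E n} (hx : x ∈ cube n) (hxd : x + d ∈ cube n)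
    (hd : ∀ i, 0 ≤ d i) : inner ℝ (grad F (x + d)) d ≤ F (x + d) - F x := by
  have hc := hDR.concaveOn_line hF hx hxd hd
  have h := hc.le_slope_of_hasDerivWithinAt (x := 0) (y := 1) (by simp) (by simp) one_pos
    (hasDerivWithinAt_line hF hx hxd (by simp))
  simpa [slope_def_field] using h

theorem IsDRSubmodular.le_line (hDR : IsDRSubmodular F)
    (hF : DifferentiableOn ℝ F (cube n)) {x d : E n} (hx : x ∈ cube n) (hxd : x + d ∈ cube n)
    (hd : ∀ i, 0 ≤ d i) {t : ℝ} (ht : t ∈ Set.Icc (0 : ℝ) 1) :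
    (1 - t) * F x + t * F (x + d) ≤ F (x + t • d) := by
  have h := (hDR.concaveOn_line hF hx hxd hd).2 (x := 0) (y := 1) (by simp) (by simp)
    (sub_nonneg.2 ht.2) ht.1 (by ring)
  simpa using h

/-- Moving up from `x` to `y` keeps at least the fraction `m` of the value, if it keeps at least
the fraction `m` of the slack `1 - x` in every coordinate: `y` is then a convex combination of
`x`, with weight `m`, and of another point of the box above `x`. -/
theorem IsDRSubmodular.mul_le_of_slack (hDR : IsDRSubmodular F)
    (hF : DifferentiableOn ℝ F (cube n)) (h0 : ∀ z ∈ cube n, 0 ≤ F z) {x y : E n}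
    (hx : x ∈ cube n) (hxy : ∀ i, x i ≤ y i) {m : ℝ} (hm0 : 0 ≤ m)
    (hm1 : m ≤ 1) (hm : ∀ i, m * (1 - x i) ≤ 1 - y i) : m * F x ≤ F y := by
  rcases hm1.eq_or_lt with rfl | hm1
  · have : x = y := by
      ext i
      linarith [hm i, hxy i]
    simp [this]
  · have hm' : 0 < 1 - m := by linarith
    have hd : ∀ i, 0 ≤ ((1 - m)⁻¹ • (y - x)) i := fun i => by
      have := mul_nonneg (inv_nonneg.2 hm'.le) (sub_nonneg.2 (hxy i))
      simpa using this
    have hxd : x + (1 - m)⁻¹ • (y - x) ∈ cube n := by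
      intro i
      refine ⟨add_nonneg (hx i).1 (hd i), ?_⟩
      have : (1 - m)⁻¹ * (y i - x i) ≤ 1 - x i := by
        rw [inv_mul_le_iff₀ hm']
        linarith [hm i]
      simp only [PiLp.add_apply, PiLp.smul_apply, PiLp.sub_apply, smul_eq_mul]
      linarith
    have h := hDR.le_line hF hx hxd hd (t := 1 - m) ⟨hm'.le, by linarith⟩
    rw [smul_smul, mul_inv_cancel₀ hm'.ne', one_smul, add_sub_cancel] at h
    have := mul_nonneg hm'.le (h0 _ hxd)
    linarith

/-! ### Smoothness -/

/-- The first-order lower bound given by smoothness, from the mean value theorem. -/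
theorem IsLSmooth.le_add {L : ℝ} (hL : 0 ≤ L) (hF : IsLSmooth F L) {x d : E n}
    (hx : x ∈ cube n) (hxd : x + d ∈ cube n) :
    F x + inner ℝ (grad F x) d - L * ‖d‖ ^ 2 ≤ F (x + d) := by
  obtain ⟨t, ht, hs⟩ := exists_hasDerivAt_eq_slope (fun s : ℝ => F (x + s • d))
    (fun t => inner ℝ (grad F (x + t • d)) d) one_pos
    (fun t ht => (hasDerivWithinAt_line hF.1 hx hxd ht).continuousWithinAt)
    (fun t ht => (hasDerivWithinAt_line hF.1 hx hxd (Set.Ioo_subset_Icc_self ht)).hasDerivAt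
      (Icc_mem_nhds ht.1 ht.2))
  have h1 := hF.2 x hx (x + t • d) (add_smul_mem_cube hx hxd (Set.Ioo_subset_Icc_self ht))
  have h2 : inner ℝ (grad F x - grad F (x + t • d)) d ≤ L * ‖d‖ ^ 2 := by
    calc inner ℝ (grad F x - grad F (x + t • d)) d
        ≤ ‖grad F x - grad F (x + t • d)‖ * ‖d‖ := real_inner_le_norm _ _
      _ ≤ (L * ‖x - (x + t • d)‖) * ‖d‖ := by gcongr
      _ = (L * (t * ‖d‖)) * ‖d‖ := by
        rw [sub_add_cancel_left, norm_neg, norm_smul, Real.norm_of_nonneg ht.1.le]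
      _ ≤ (L * (1 * ‖d‖)) * ‖d‖ := by gcongr; exact ht.2.le
      _ = L * ‖d‖ ^ 2 := by ring
  rw [inner_sub_left] at h2
  simp at hs
  linarith

/-! ### Product distributions on the subsets of the coordinates -/

theorem drawProb_nonneg {y : E n} (hy : y ∈ cube n) (A : Finset (Fin n)) : 0 ≤ drawProb y A :=
  mul_nonneg (Finset.prod_nonneg fun i _ => (hy i).1)
    (Finset.prod_nonneg fun i _ => sub_nonneg.2 (hy i).2)

theorem sum_drawProb (y : E n) : ∑ A, drawProb y A = 1 := by
  have h := Finset.prod_add (fun i => y i) (fun i => 1 - y i) (Finset.univ : Finset (Fin n))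
  simp only [add_sub_cancel, Finset.prod_const_one, Finset.powerset_univ] at h
  rw [h]
  simp [drawProb, Finset.compl_eq_univ_sdiff]

/-- Rounding the coordinates of `b + d ⊙ y` independently to those of `b` or `b + d`, with mean
`b + d ⊙ y`, does not increase the value on average: `F` is concave in each coordinate. -/
theorem IsDRSubmodular.sum_drawProb_le (hDR : IsDRSubmodular F)
    (hF : DifferentiableOn ℝ F (cube n)) {b d y : E n} (hb : b ∈ cube n)
    (hbd : b + d ∈ cube n) (hd : ∀ i, 0 ≤ d i) (hy : y ∈ cube n) :
    ∑ A, drawProb y A * F (b + restrict d A) ≤ F (b + hadamard d y) := by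
  have key : ∀ (S : Finset (Fin n)) (b : E n), b ∈ cube n → b + restrict d S ∈ cube n →
      ∑ A ∈ S.powerset, ((∏ i ∈ A, y i) * ∏ i ∈ S \ A, (1 - y i)) * F (b + restrict d A)
        ≤ F (b + restrict (hadamard d y) S) := by
    intro S
    induction S using Finset.induction_on with
    | empty => intro b _ _; simp [restrict_empty]
    | insert i S hi ih =>
      intro b hb hbS
      have hR0 : ∀ k, 0 ≤ restrict d S k := fun k => by
        rw [restrict_apply]; split_ifs; exacts [hd k, le_rfl]
      have hs0 : ∀ k, 0 ≤ EuclideanSpace.single i (d i) k := fun k => by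
        rw [PiLp.single_apply]; split_ifs; exacts [hd i, le_rfl]
      rw [restrict_insert d hi] at hbS
      have hb1 : b + EuclideanSpace.single i (d i) ∈ cube n :=
        mem_cube_of_le hb hbS (fun k => by simpa using hs0 k)
          (fun k => by have := hR0 k; simp only [PiLp.add_apply]; linarith)
      have hb2 : b + restrict d S ∈ cube n :=
        mem_cube_of_le hb hbS (fun k => by simpa using hR0 k)
          (fun k => by have := hs0 k; simp only [PiLp.add_apply]; linarith)
      have hb3 : b + EuclideanSpace.single i (d i) + restrict d S ∈ cube n := by
        rw [add_assoc, add_comm (EuclideanSpace.single i (d i))]; exact hbS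
      have hRy : ∀ k, 0 ≤ restrict (hadamard d y) S k ∧
          restrict (hadamard d y) S k ≤ restrict d S k := fun k => by
        simp only [restrict_apply, hadamard_apply]
        split_ifs
        · exact ⟨mul_nonneg (hd k) (hy k).1, mul_le_of_le_one_right (hd k) (hy k).2⟩
        · exact ⟨le_rfl, le_rfl⟩
      have hc1 : b + restrict (hadamard d y) S ∈ cube n :=
        mem_cube_of_le hb hb2 (fun k => by simpa using (hRy k).1)
          (fun k => by simpa using (hRy k).2)
      have hc2 : b + restrict (hadamard d y) S + EuclideanSpace.single i (d i) ∈ cube n := by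
        rw [add_right_comm]
        exact mem_cube_of_le hb1 hb3 (fun k => by simpa using (hRy k).1)
          (fun k => by simpa using (hRy k).2)
      have hline := hDR.le_line hF hc1 hc2 hs0 (hy i)
      have e1 : b + restrict (hadamard d y) (insert i S) =
          b + restrict (hadamard d y) S + y i • EuclideanSpace.single i (d i) := by
        rw [restrict_insert _ hi, ← add_assoc]
        congr 1
        ext k
        by_cases hk : k = i
        · subst hk; simp [mul_comm]
        · simp [hk]
      have ih1 := ih b hb hb2
      have ih2 := ih _ hb1 hb3
      rw [add_right_comm] at ih2
      rw [e1, Finset.sum_powerset_insert hi]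
      refine le_trans (le_of_eq ?_) (le_trans (add_le_add
        (mul_le_mul_of_nonneg_left ih1 (sub_nonneg.2 (hy i).2))
        (mul_le_mul_of_nonneg_left ih2 (hy i).1)) hline)
      rw [Finset.mul_sum, Finset.mul_sum]
      congr 1
      · refine Finset.sum_congr rfl fun A hA => ?_
        have hiA : i ∉ A := fun h => hi (Finset.mem_powerset.1 hA h)
        rw [Finset.insert_sdiff_of_notMem _ hiA,
          Finset.prod_insert (fun h => hi (Finset.mem_sdiff.1 h).1)]
        ring
      · refine Finset.sum_congr rfl fun A hA => ?_
        have hiA : i ∉ A := fun h => hi (Finset.mem_powerset.1 hA h)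
        have e2 : insert i S \ insert i A = S \ A := by
          ext k
          simp only [Finset.mem_sdiff, Finset.mem_insert]
          constructor
          · tauto
          · rintro ⟨h1, h2⟩
            refine ⟨Or.inr h1, ?_⟩
            rintro (rfl | h)
            exacts [hi h1, h2 h]
        rw [e2, Finset.prod_insert hiA, restrict_insert d hiA,
          add_comm (restrict d A), ← add_assoc]
        ring
  simpa [restrict_univ, drawProb, Finset.compl_eq_univ_sdiff] using
    key Finset.univ b hb (by rwa [restrict_univ])

/-! ### Numerical estimates -/

theorem exp_372_bounds : 1.4506 ≤ Real.exp 0.372 ∧ Real.exp 0.372 ≤ 1.4507 := by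
  have h := Real.exp_bound (x := 0.372) (by norm_num [abs_of_pos]) (n := 6) (by norm_num)
  rw [abs_le] at h
  norm_num [Finset.sum_range_succ, Nat.factorial] at h
  constructor <;> norm_num <;> linarith [h.1, h.2]

/-- Linear lower and quadratic upper bounds for `exp` near `0.372`. -/
theorem exp_near_372 {t : ℝ} (ht : |t - 0.372| ≤ 0.001) :
    1.4506 * (1 + (t - 0.372)) ≤ Real.exp t ∧
      Real.exp t ≤ 1.4507 * (1 + (t - 0.372) + (t - 0.372) ^ 2) := by
  have h1 := Real.add_one_le_exp (t - 0.372)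
  have h2 := (abs_le.1 (Real.abs_exp_sub_one_sub_id_le (x := t - 0.372) (by linarith))).2
  obtain ⟨c1, c2⟩ := exp_372_bounds
  have h3 : Real.exp t = Real.exp 0.372 * Real.exp (t - 0.372) := by
    rw [← Real.exp_add]; ring_nf
  have h4 := abs_le.1 ht
  rw [h3]
  constructor
  · exact mul_le_mul c1 (by linarith) (by linarith) (by linarith)
  · exact mul_le_mul c2 (by linarith) (Real.exp_pos _).le (by linarith)

/-- Bounds for the part of the denominator of `outProb θ` other than `e`, which is `e` times the
ratio of `1 - outProb θ` to `outProb θ`. -/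
theorem weight_bounds {θ : ℝ} (hθ : |θ - 0.372| ≤ 0.0005) :
    0.8109 ≤ Real.exp θ * (3 - θ) - 3 ∧ Real.exp θ * (3 - θ) - 3 ≤ 0.8137 := by
  obtain ⟨h1, h2⟩ := exp_near_372 (hθ.trans (by norm_num))
  obtain ⟨h3, h4⟩ := abs_le.1 hθ
  have h5 : 0 ≤ 3 - θ := by linarith
  have h6 := mul_le_mul_of_nonneg_right h1 h5
  have h7 := mul_le_mul_of_nonneg_right h2 h5
  obtain ⟨s, rfl⟩ : ∃ s, θ = s + 0.372 := ⟨θ - 0.372, by ring⟩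
  simp only [add_sub_cancel_right] at *
  have hs2 : s ^ 2 ≤ 0.0005 ^ 2 := sq_le_sq' (by linarith) h4
  constructor
  · nlinarith
  · nlinarith [mul_nonneg (sq_nonneg s) (by linarith : (0 : ℝ) ≤ s + 0.0005)]

theorem outProb_div_exp_bounds {θ : ℝ} (hθ : |θ - 0.372| ≤ 0.0005) :
    0.28312 ≤ outProb θ / Real.exp 1 ∧ outProb θ / Real.exp 1 ≤ 0.28336 := by
  obtain ⟨h1, h2⟩ := weight_bounds hθ
  have e1 := Real.exp_one_gt_d9
  have e2 := Real.exp_one_lt_d9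
  have e3 := Real.exp_pos 1
  have hr : outProb θ / Real.exp 1 = 1 / (Real.exp 1 + Real.exp θ * (3 - θ) - 3) := by
    rw [outProb]; field_simp
  rw [hr, le_div_iff₀ (by linarith), div_le_iff₀ (by linarith)]
  constructor <;> linarith

theorem abs_outProb_sub_le {θ : ℝ} (hθ : |θ - 0.372| ≤ 0.0005) :
    |outProb θ - 0.77| ≤ 0.0005 := by
  obtain ⟨h1, h2⟩ := weight_bounds hθ
  have e1 := Real.exp_one_gt_d9
  have e2 := Real.exp_one_lt_d9
  rw [abs_le, outProb, neg_le_sub_iff_le_add, sub_le_iff_le_add, ← sub_le_iff_le_add,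
    le_div_iff₀ (by linarith), div_le_iff₀ (by linarith)]
  constructor <;> linarith

/-- The defining property of `outProb θ`: the weight of the stationary point balances the losses of
the two-phase run. -/
theorem one_sub_outProb {θ : ℝ} (hθ : |θ - 0.372| ≤ 0.0005) :
    1 - outProb θ = outProb θ / Real.exp 1 * (Real.exp θ * (3 - θ) - 3) := by
  obtain ⟨h1, _⟩ := weight_bounds hθ
  have e1 := Real.exp_one_gt_d9
  have h2 : Real.exp 1 + Real.exp θ * (3 - θ) - 3 ≠ 0 := by linarith
  rw [outProb]
  field_simp
  ring

/-- The loss in the balance when the fraction `τ` of first-phase steps differs from `θ`. -/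
theorem weight_sub_le {θ τ : ℝ} (hθ : |θ - 0.372| ≤ 0.0005) (hτ : |τ - θ| ≤ 0.00001) :
    Real.exp τ * (3 - τ) - Real.exp θ * (3 - θ) ≤ 0.0001 := by
  obtain ⟨h3, h4⟩ := abs_le.1 hθ
  obtain ⟨h5, h6⟩ := abs_le.1 hτ
  have ht : |τ - 0.372| ≤ 0.001 := by rw [abs_le]; constructor <;> linarith
  obtain ⟨_, h2⟩ := exp_near_372 ht
  have hE : Real.exp τ ≤ 1.46 := by nlinarith
  have h7 : Real.exp τ * (1 + (θ - τ)) ≤ Real.exp θ := by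
    have : Real.exp θ = Real.exp τ * Real.exp (θ - τ) := by rw [← Real.exp_add]; ring_nf
    rw [this]
    exact mul_le_mul_of_nonneg_left (by linarith [Real.add_one_le_exp (θ - τ)])
      (Real.exp_pos _).le
  have h8 := mul_le_mul_of_nonneg_right h7 (by linarith : 0 ≤ 3 - θ)
  have h9 : Real.exp τ * ((τ - θ) * (2 - θ)) ≤ 1.46 * (0.00001 * 1.63) := by
    have : (τ - θ) * (2 - θ) ≤ 0.00001 * 1.63 :=
      mul_le_mul h6 (by linarith) (by linarith) (by norm_num)
    calc Real.exp τ * ((τ - θ) * (2 - θ)) ≤ Real.exp τ * (0.00001 * 1.63) :=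
          mul_le_mul_of_nonneg_left this (Real.exp_pos _).le
      _ ≤ _ := mul_le_mul_of_nonneg_right hE (by norm_num)
  nlinarith

/-- Bounds that determine, up to the factor `outProb θ / e`, the coefficient `e^τ (2 - τ) - 1` of
the optimum and the coefficient `e^τ (2 - τ) - 2` of the probabilistic sum in the final estimate. -/
theorem gain_bounds {τ : ℝ} (hτ : |τ - 0.372| ≤ 0.0006) :
    2.3609 ≤ Real.exp τ * (2 - τ) ∧ Real.exp τ * (2 - τ) ≤ 2.365 := by
  obtain ⟨h1, h2⟩ := exp_near_372 (hτ.trans (by norm_num))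
  obtain ⟨h3, h4⟩ := abs_le.1 hτ
  have h5 : 0 ≤ 2 - τ := by linarith
  have h6 := mul_le_mul_of_nonneg_right h1 h5
  have h7 := mul_le_mul_of_nonneg_right h2 h5
  obtain ⟨s, rfl⟩ : ∃ s, τ = s + 0.372 := ⟨τ - 0.372, by ring⟩
  simp only [add_sub_cancel_right] at *
  have hs2 : s ^ 2 ≤ 0.0006 ^ 2 := sq_le_sq' (by linarith) h4
  constructor
  · nlinarith
  · nlinarith [mul_nonneg (sq_nonneg s) (by linarith : (0 : ℝ) ≤ s + 0.0006)]

/-- The combination of the guarantee for the last iterate, of expected value `G`, with the two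
consequences of stationarity, where `O`, `r`, `s` and `f` stand for the values at the optimum `o`,
at `o ⊙ y`, at the probabilistic sum of `o` and `y`, and at `y`, and `δ` is the loss from
discretization. -/
theorem combine_bounds {θ τ O r s f G δ ε : ℝ} (hθ : |θ - 0.372| ≤ 0.0005)
    (hτ : |τ - θ| ≤ 0.00001) (hε : 0 < ε) (hr0 : 0 ≤ r) (hrO : r ≤ O)
    (hδ : δ ≤ 0.00001 * ε) (hf1 : r - ε ≤ f) (hf2 : r + s - ε ≤ 2 * f)
    (hG : Real.exp (τ - 1) * ((2 - τ - Real.exp (-τ)) * O - (1 - Real.exp (-τ)) * r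
      - (2 - τ - 2 * Real.exp (-τ)) * s) - δ ≤ G) :
    0.385 * O - ε < outProb θ * G + (1 - outProb θ) * f := by
  obtain ⟨h3, h4⟩ := abs_le.1 hθ
  obtain ⟨h5, h6⟩ := abs_le.1 hτ
  have ht : |τ - 0.372| ≤ 0.0006 := by rw [abs_le]; constructor <;> linarith
  obtain ⟨g1, g2⟩ := gain_bounds ht
  obtain ⟨w1, w2⟩ := weight_bounds hθ
  obtain ⟨k1, k2⟩ := outProb_div_exp_bounds hθ
  obtain ⟨p1, p2⟩ := abs_le.1 (abs_outProb_sub_le hθ)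
  have hw := weight_sub_le hθ hτ
  have h1p := one_sub_outProb hθ
  have hexp : Real.exp (τ - 1) = Real.exp τ / Real.exp 1 := Real.exp_sub _ _
  have hinv : Real.exp τ * Real.exp (-τ) = 1 := by rw [← Real.exp_add]; simp
  set κ := outProb θ / Real.exp 1 with hκ
  set p := outProb θ with hp
  set u := Real.exp τ with hu
  -- The lower bound on `p * G`, with the factor `e^τ` multiplied out.
  have hpG : κ * ((u * (2 - τ) - 1) * O - (u - 1) * r - (u * (2 - τ) - 2) * s) - p * δ
      ≤ p * G := by
    refine le_trans (le_of_eq ?_) (mul_le_mul_of_nonneg_left hG (by linarith : 0 ≤ p))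
    rw [hexp, hκ]
    linear_combination p / Real.exp 1 * (O - r - 2 * s) * hinv
  -- `β` is the weight of the second stationarity bound: it cancels the term in `s`.
  obtain ⟨β, hβ⟩ : ∃ β, β = κ * (u * (2 - τ) - 2) := ⟨_, rfl⟩
  have hκ0 : 0 ≤ κ := by linarith
  clear_value κ p u
  have hβ0 : 0 ≤ β := hβ ▸ mul_nonneg hκ0 (by linarith)
  have hβ1 : 2 * β ≤ 1 - p := by
    have := mul_le_mul_of_nonneg_left
      (by linarith : 2 * (u * (2 - τ) - 2) ≤ Real.exp θ * (3 - θ) - 3) hκ0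
    rw [hβ, h1p]
    linarith
  have hy : β * (r + s - ε) + (1 - p - 2 * β) * (r - ε) ≤ (1 - p) * f := by
    have a1 := mul_le_mul_of_nonneg_left hf2 hβ0
    have a2 := mul_le_mul_of_nonneg_left hf1 (by linarith : 0 ≤ 1 - p - 2 * β)
    linarith
  have hcoef : -0.00003 ≤ 1 - p - β - κ * (u - 1) := by
    have := mul_le_mul_of_nonneg_left hw hκ0
    rw [h1p, hβ]
    linarith
  have hO : 0.3852 * O ≤ κ * (u * (2 - τ) - 1) * O := by
    refine mul_le_mul_of_nonneg_right ?_ (hr0.trans hrO)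
    have := mul_le_mul k1 (by linarith : 1.3609 ≤ u * (2 - τ) - 1) (by norm_num) hκ0
    linarith
  have hrr := mul_le_mul_of_nonneg_right hcoef hr0
  have hpδ : p * δ ≤ 0.00001 * ε :=
    (mul_le_mul_of_nonneg_left hδ (by linarith)).trans
      (mul_le_of_le_one_left (by linarith) (by linarith))
  have hεβ : (1 - p - β) * ε ≤ 0.5 * ε :=
    mul_le_mul_of_nonneg_right (by linarith) hε.le
  have hβs : β * s = κ * (u * (2 - τ) - 2) * s := by rw [hβ]
  linarith

/-! ### Solving the recursions of the two phases -/

/-- The first phase, with `q = e^{-h}` for `h = 1 / N`. The exact solution has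
`j * (1 - q) * q ^ (j - 1)` in place of `j * h * q ^ j`; the hypothesis `q * (1 + h) ≤ 1` says that
this replacement is a lower bound. -/
theorem first_phase_recursion {f : ℕ → ℝ} {q h a b η : ℝ} {m : ℕ} (hq0 : 0 ≤ q) (hq1 : q ≤ 1)
    (hqh : q * (1 + h) ≤ 1) (hb : 0 ≤ b) (hη : 0 ≤ η) (h0 : 0 ≤ f 0)
    (hf : ∀ j < m, q * f j + (1 - q) * (a - (1 - q ^ j) * b) - η ≤ f (j + 1)) :
    ∀ j ≤ m, (1 - q ^ j) * a - (1 - q ^ j - j * h * q ^ j) * b - j * η ≤ f j := by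
  intro j
  induction j with
  | zero => intro _; simpa using h0
  | succ j ih =>
    intro hj
    have h1 := mul_le_mul_of_nonneg_left (ih (by omega)) hq0
    have h2 := hf j hj
    have h3 : 0 ≤ (1 - q * (1 + h)) * q ^ j * b :=
      mul_nonneg (mul_nonneg (sub_nonneg.2 hqh) (pow_nonneg hq0 j)) hb
    have h4 : q * (j * η) ≤ j * η := mul_le_of_le_one_left (by positivity) hq1
    push_cast
    rw [pow_succ]
    linarith

/-- The second phase, with `j` counted from its beginning. As `f` is non-negative, the factor
`1 - q * h` may be lowered to `q`. -/
theorem second_phase_recursion {f : ℕ → ℝ} {q h K η : ℝ} {m : ℕ} (hq0 : 0 ≤ q) (hq1 : q ≤ 1)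
    (hqh : q * (1 + h) ≤ 1) (hη : 0 ≤ η) (h0 : ∀ j ≤ m, 0 ≤ f j)
    (hf : ∀ j < m, (1 - q * h) * f j + q * h * (q ^ j * K) - η ≤ f (j + 1)) :
    ∀ j ≤ m, q ^ j * (f 0 + j * h * K) - j * η ≤ f j := by
  intro j
  induction j with
  | zero => intro _; simp
  | succ j ih =>
    intro hj
    have h1 := mul_le_mul_of_nonneg_left (ih (by omega)) hq0
    have h2 := hf j hj
    have h3 : 0 ≤ (1 - q * (1 + h)) * f j :=
      mul_nonneg (sub_nonneg.2 hqh) (h0 j (by omega))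
    have h4 : q * (j * η) ≤ j * η := mul_le_of_le_one_left (by positivity) hq1
    push_cast
    rw [pow_succ]
    linarith

/-! ### The feasible domain -/

theorem isBounded_cube : Bornology.IsBounded (cube n) := by
  have hc : IsCompact ((fun f : Fin n → ℝ => (WithLp.toLp 2 f : E n)) ''
      Set.univ.pi fun _ => Set.Icc (0 : ℝ) 1) :=
    (isCompact_univ_pi fun _ => isCompact_Icc).image (PiLp.continuous_toLp 2 _)
  refine hc.isBounded.subset fun x hx => ⟨x.ofLp, fun i _ => hx i, rfl⟩

theorem IsFeasibleDomain.isBounded (hP : IsFeasibleDomain P) : Bornology.IsBounded P :=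
  isBounded_cube.subset hP.subset_cube

theorem IsFeasibleDomain.zero_mem (hP : IsFeasibleDomain P) : (0 : E n) ∈ P := by
  obtain ⟨x, hx⟩ := hP.nonempty
  exact hP.downClosed x hx 0 fun i => ⟨le_rfl, (hP.subset_cube hx i).1⟩

theorem IsFeasibleDomain.norm_sq_le (hP : IsFeasibleDomain P) {v : E n} (hv : v ∈ P) :
    ‖v‖ ^ 2 ≤ sqDiam P := by
  have h := Metric.dist_le_diam_of_mem hP.isBounded hv hP.zero_mem
  rw [dist_zero_right] at h
  exact pow_le_pow_left₀ (norm_nonneg v) h 2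

theorem IsFeasibleDomain.exists_optValue (hP : IsFeasibleDomain P)
    (hF : DifferentiableOn ℝ F (cube n)) :
    ∃ o ∈ P, F o = optValue F P ∧ ∀ z ∈ P, F z ≤ F o := by
  obtain ⟨o, ho, hmax⟩ := (Metric.isCompact_of_isClosed_isBounded hP.closed
    hP.isBounded).exists_isMaxOn hP.nonempty (hF.continuousOn.mono hP.subset_cube)
  have h : IsGreatest (F '' P) (F o) :=
    ⟨Set.mem_image_of_mem F ho, by rintro _ ⟨z, hz, rfl⟩; exact hmax hz⟩
  exact ⟨o, ho, h.csSup_eq.symm, fun z hz => hmax hz⟩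

/-! ### Stationary points -/

/-- The part of the gap inequality that concerns the feasible point `o ⊙ y ≤ y`. -/
theorem IsStationaryWithGap.sub_le (hP : IsFeasibleDomain P) (hDR : IsDRSubmodular F)
    (hF : DifferentiableOn ℝ F (cube n)) {ε : ℝ} {y o : E n} (hy : IsStationaryWithGap F P ε y)
    (ho : o ∈ P) : F (hadamard o y) - ε ≤ F y := by
  have hyc := hP.subset_cube hy.1
  have hoc := hP.subset_cube ho
  have hle : ∀ i, 0 ≤ hadamard o y i ∧ hadamard o y i ≤ y i := fun i =>
    ⟨mul_nonneg (hoc i).1 (hyc i).1, mul_le_of_le_one_left (hyc i).1 (hoc i).2⟩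
  have hmem : hadamard o y ∈ P := hP.downClosed y hy.1 _ hle
  have h1 := hDR.inner_le_sub hF (x := hadamard o y) (d := y - hadamard o y)
    (hP.subset_cube hmem) (by rwa [add_sub_cancel]) (fun i => sub_nonneg.2 (hle i).2)
  have h2 := hy.2 _ hmem
  rw [add_sub_cancel] at h1
  rw [← neg_sub, inner_neg_right] at h2
  linarith

/-- The increments from `y` to `o ⊙ y` and to the probabilistic sum of `o` and `y` add up to
`o - y`, and each is along a direction of constant sign. -/
theorem IsStationaryWithGap.add_sub_le (hP : IsFeasibleDomain P) (hDR : IsDRSubmodular F)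
    (hF : DifferentiableOn ℝ F (cube n)) {ε : ℝ} {y o : E n} (hy : IsStationaryWithGap F P ε y)
    (ho : o ∈ P) :
    F (hadamard o y) + F (o + hadamard (slack o) y) - ε ≤ 2 * F y := by
  have hyc := hP.subset_cube hy.1
  have hoc := hP.subset_cube ho
  have hle : ∀ i, 0 ≤ hadamard o y i ∧ hadamard o y i ≤ y i := fun i =>
    ⟨mul_nonneg (hoc i).1 (hyc i).1, mul_le_of_le_one_left (hyc i).1 (hoc i).2⟩
  have h1 := hDR.inner_le_sub hF (x := hadamard o y) (d := y - hadamard o y)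
    (hP.subset_cube (hP.downClosed y hy.1 _ hle)) (by rwa [add_sub_cancel])
    (fun i => sub_nonneg.2 (hle i).2)
  have e : y + (o - hadamard o y) = o + hadamard (slack o) y := by
    ext i
    simp only [PiLp.add_apply, PiLp.sub_apply, hadamard_apply, slack_apply]
    ring
  have h2 := hDR.sub_le_inner hF (x := y) (d := o - hadamard o y) hyc
    (by
      rw [e]
      intro i
      have a := hoc i
      have b := hyc i
      simp only [PiLp.add_apply, hadamard_apply, slack_apply]
      constructor <;> nlinarith)
    (fun i => sub_nonneg.2 (mul_le_of_le_one_right (hoc i).1 (hyc i).2))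
  have h3 := hy.2 o ho
  rw [add_sub_cancel] at h1
  rw [e] at h2
  have h4 : inner ℝ (grad F y) (o - y) = inner ℝ (grad F y) (o - hadamard o y)
      - inner ℝ (grad F y) (y - hadamard o y) := by
    rw [← inner_sub_right]
    congr 1
    abel
  linarith

/-! ### The iterates of a run -/

theorem exp_neg_mul_one_add_le (h : ℝ) : Real.exp (-h) * (1 + h) ≤ 1 := by
  have h1 := mul_le_mul_of_nonneg_left (Real.add_one_le_exp h) (Real.exp_pos (-h)).le
  rw [← Real.exp_add, neg_add_cancel, Real.exp_zero] at h1
  linarith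

theorem stepSize_of_lt {N₁ j : ℕ} (N₂ : ℕ) (hj : j < N₁) :
    stepSize N₁ N₂ j = 1 - Real.exp (-((N₁ : ℝ) + N₂)⁻¹) := by
  rw [stepSize, if_pos hj, neg_div, one_div]

theorem stepSize_of_le {N₁ j : ℕ} (N₂ : ℕ) (hj : N₁ ≤ j) :
    stepSize N₁ N₂ j = Real.exp (-((N₁ : ℝ) + N₂)⁻¹) * ((N₁ : ℝ) + N₂)⁻¹ := by
  rw [stepSize, if_neg hj.not_gt, one_div, mul_inv, one_div, Real.exp_neg, mul_comm]

theorem stepSize_bounds (N₁ N₂ j : ℕ) :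
    0 ≤ stepSize N₁ N₂ j ∧ stepSize N₁ N₂ j ≤ 1 - Real.exp (-((N₁ : ℝ) + N₂)⁻¹) ∧
      stepSize N₁ N₂ j ≤ ((N₁ : ℝ) + N₂)⁻¹ := by
  have hh : 0 ≤ ((N₁ : ℝ) + N₂)⁻¹ := by positivity
  have h1 := exp_neg_mul_one_add_le ((N₁ : ℝ) + N₂)⁻¹
  have h2 := Real.add_one_le_exp (-((N₁ : ℝ) + N₂)⁻¹)
  have h3 : Real.exp (-((N₁ : ℝ) + N₂)⁻¹) ≤ 1 := Real.exp_le_one_iff.2 (by linarith)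
  rcases lt_or_ge j N₁ with hj | hj
  · rw [stepSize_of_lt N₂ hj]
    exact ⟨by linarith, le_rfl, by linarith⟩
  · rw [stepSize_of_le N₂ hj]
    exact ⟨by positivity, by linarith, mul_le_of_le_one_left hh h3⟩

theorem directionBound_le {A : Finset (Fin n)} {N₁ j : ℕ} {x : E n} (hx : x ∈ cube n)
    (i : Fin n) : directionBound A N₁ j x i ≤ 1 - x i := by
  rw [directionBound]
  split_ifs
  exacts [sub_nonneg.2 (hx i).2, le_rfl]

section Run

variable {A : Finset (Fin n)} {N₁ N₂ : ℕ} {x : ℕ → E n}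

/-- One step raises every coordinate and keeps at least the fraction `e^{-1/N}` of its slack. -/
theorem IsRun.step_slack (hP : IsFeasibleDomain P) (hx : IsRun F P A N₁ N₂ x) {j : ℕ}
    (hj : j < N₁ + N₂) (hxj : x j ∈ cube n) (i : Fin n) :
    x j i ≤ x (j + 1) i ∧
      Real.exp (-((N₁ : ℝ) + N₂)⁻¹) * (1 - x j i) ≤ 1 - x (j + 1) i := by
  obtain ⟨v, ⟨⟨hv, hvu⟩, _⟩, hstep⟩ := hx.2 j hj
  obtain ⟨s0, s1, _⟩ := stepSize_bounds N₁ N₂ j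
  have h0 := (hP.subset_cube hv i).1
  have h1 := (hvu i).trans (directionBound_le hxj i)
  have e : x (j + 1) i = x j i + stepSize N₁ N₂ j * v i := by rw [hstep]; simp
  rw [e]
  have h2 : stepSize N₁ N₂ j * v i ≤ (1 - Real.exp (-((N₁ : ℝ) + N₂)⁻¹)) * (1 - x j i) :=
    mul_le_mul s1 h1 h0 (s0.trans s1)
  exact ⟨le_add_of_nonneg_right (mul_nonneg s0 h0), by linarith⟩

theorem IsRun.mem_cube (hP : IsFeasibleDomain P) (hx : IsRun F P A N₁ N₂ x) :
    ∀ j ≤ N₁ + N₂, x j ∈ cube n := by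
  intro j
  induction j with
  | zero => intro _ i; rw [hx.1]; simp
  | succ j ih =>
    intro hj i
    have hxj := ih (by omega)
    obtain ⟨h1, h2⟩ := hx.step_slack hP hj hxj i
    have h3 := mul_nonneg (Real.exp_pos (-((N₁ : ℝ) + N₂)⁻¹)).le (sub_nonneg.2 (hxj i).2)
    exact ⟨(hxj i).1.trans h1, by linarith⟩

theorem IsRun.slack_le (hP : IsFeasibleDomain P) (hx : IsRun F P A N₁ N₂ x) (j : ℕ) :
    ∀ k, j + k ≤ N₁ + N₂ → ∀ i, x j i ≤ x (j + k) i ∧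
      Real.exp (-((N₁ : ℝ) + N₂)⁻¹) ^ k * (1 - x j i) ≤ 1 - x (j + k) i := by
  intro k
  induction k with
  | zero => intro _ i; simp
  | succ k ih =>
    intro hk i
    obtain ⟨h1, h2⟩ := ih (by omega) i
    obtain ⟨h3, h4⟩ := hx.step_slack hP (j := j + k) (by omega)
      (hx.mem_cube hP _ (by omega)) i
    have h5 := mul_le_mul_of_nonneg_left h2 (Real.exp_pos (-((N₁ : ℝ) + N₂)⁻¹)).le
    rw [← add_assoc, pow_succ']
    exact ⟨h1.trans h3, by linarith⟩

theorem IsRun.pow_le_slack (hP : IsFeasibleDomain P) (hx : IsRun F P A N₁ N₂ x) {j : ℕ}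
    (hj : j ≤ N₁ + N₂) (i : Fin n) :
    Real.exp (-((N₁ : ℝ) + N₂)⁻¹) ^ j ≤ 1 - x j i := by
  have h := (hx.slack_le hP 0 j (by omega) i).2
  rw [zero_add, hx.1] at h
  simpa using h

theorem IsRun.eq_zero_of_mem (hP : IsFeasibleDomain P) (hx : IsRun F P A N₁ N₂ x) {i : Fin n}
    (hi : i ∈ A) : ∀ j ≤ N₁, x j i = 0 := by
  intro j
  induction j with
  | zero => intro _; rw [hx.1]; simp
  | succ j ih =>
    intro hj
    obtain ⟨v, ⟨⟨hv, hvu⟩, _⟩, hstep⟩ := hx.2 j (by omega)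
    have h1 := hvu i
    rw [directionBound, if_pos ⟨hj, hi⟩] at h1
    have h2 : v i = 0 := le_antisymm h1 (hP.subset_cube hv i).1
    rw [hstep]
    simp [ih (by omega), h2]

/-- The steps sum to at most `1`, so that `x j` is `j / N` times a feasible point. -/
theorem IsRun.mem (hP : IsFeasibleDomain P) (hx : IsRun F P A N₁ N₂ x) {j : ℕ}
    (hj : j ≤ N₁ + N₂) : x j ∈ P := by
  rcases Nat.eq_zero_or_pos (N₁ + N₂) with hN | hN
  · rw [show j = 0 by omega, hx.1]
    exact hP.zero_mem
  have hN' : (0 : ℝ) < (N₁ : ℝ) + N₂ := by exact_mod_cast hN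
  set h := ((N₁ : ℝ) + N₂)⁻¹ with hh
  have hh0 : 0 < h := inv_pos.2 hN'
  have key : ∀ j ≤ N₁ + N₂, ∃ w ∈ P, x j = (j * h : ℝ) • w := by
    intro j
    induction j with
    | zero => intro _; exact ⟨0, hP.zero_mem, by simp [hx.1]⟩
    | succ j ih =>
      intro hj
      obtain ⟨w, hw, hxw⟩ := ih (by omega)
      obtain ⟨v, ⟨⟨hv, _⟩, _⟩, hstep⟩ := hx.2 j hj
      obtain ⟨s0, _, s1⟩ := stepSize_bounds N₁ N₂ j
      rw [← hh] at s1
      have hv' : (stepSize N₁ N₂ j / h) • v ∈ P := by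
        have := hP.convex.smul_mem_of_zero_mem hP.zero_mem hv
          (t := stepSize N₁ N₂ j / h) ⟨by positivity, (div_le_one hh0).2 s1⟩
        exact this
      have hj1 : (0 : ℝ) < (j : ℝ) + 1 := by positivity
      refine ⟨(j / (j + 1) : ℝ) • w + (1 / (j + 1) : ℝ) • (stepSize N₁ N₂ j / h) • v,
        hP.convex hw hv' (by positivity) (by positivity) (by field_simp), ?_⟩
      rw [hstep, hxw, smul_add, smul_smul, smul_smul, smul_smul]
      congr 2
      · push_cast; field_simp
      · push_cast; field_simp
  obtain ⟨w, hw, hxw⟩ := key j hj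
  rw [hxw]
  refine hP.convex.smul_mem_of_zero_mem hP.zero_mem hw ⟨by positivity, ?_⟩
  rw [hh, ← div_eq_mul_inv, div_le_one hN']
  exact_mod_cast hj

/-- The progress of one step, compared with any feasible direction `w` within the bound. -/
theorem IsRun.step_gain (hP : IsFeasibleDomain P) (hDR : IsDRSubmodular F) {L : ℝ} (hL : 0 ≤ L)
    (hF : IsLSmooth F L) (hx : IsRun F P A N₁ N₂ x) {j : ℕ} (hj : j < N₁ + N₂) {w : E n}
    (hw : w ∈ P) (hwu : ∀ i, w i ≤ directionBound A N₁ j (x j) i) :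
    F (x j) + stepSize N₁ N₂ j * (F (x j + w) - F (x j))
      - sqDiam P * L * ((N₁ : ℝ) + N₂)⁻¹ ^ 2 ≤ F (x (j + 1)) := by
  have hxj := hx.mem_cube hP j hj.le
  have hxj1 := hx.mem_cube hP (j + 1) hj
  obtain ⟨v, ⟨⟨hv, _⟩, hmax⟩, hstep⟩ := hx.2 j hj
  obtain ⟨s0, _, s1⟩ := stepSize_bounds N₁ N₂ j
  rw [hstep] at hxj1 ⊢
  have h1 := hF.le_add hL hxj hxj1
  have hw0 := hP.subset_cube hw
  have h2 := hDR.sub_le_inner hF.1 (d := w) hxj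
    (fun i => ⟨add_nonneg (hxj i).1 (hw0 i).1, by
      have := (hwu i).trans (directionBound_le hxj i)
      simp only [PiLp.add_apply]
      linarith⟩) (fun i => (hw0 i).1)
  have h3 := mul_le_mul_of_nonneg_left (h2.trans (hmax w hw hwu)) s0
  have h4 : L * ‖stepSize N₁ N₂ j • v‖ ^ 2 ≤ sqDiam P * L * ((N₁ : ℝ) + N₂)⁻¹ ^ 2 := by
    rw [norm_smul, Real.norm_of_nonneg s0, mul_pow]
    calc L * (stepSize N₁ N₂ j ^ 2 * ‖v‖ ^ 2)
        ≤ L * (((N₁ : ℝ) + N₂)⁻¹ ^ 2 * sqDiam P) := by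
          gcongr
          exact hP.norm_sq_le hv
      _ = _ := by ring
  rw [inner_smul_right] at h1
  linarith

end Run

/-- Joining `x` to `w` loses at most the fraction `1 - m` of `F u`, if every coordinate of `x` is at
most `1 - m`, and `x` changes `w` and the larger point `u` by the same amount. -/
theorem IsDRSubmodular.sub_le_join (hDR : IsDRSubmodular F)
    (hF : DifferentiableOn ℝ F (cube n)) (h0 : ∀ z ∈ cube n, 0 ≤ F z) {w u x : E n}
    (hw : w ∈ cube n) (hu : u ∈ cube n) (hx : x ∈ cube n) (hwu : ∀ i, w i ≤ u i)
    (hxwu : ∀ i, (1 - w i) * x i = (1 - u i) * x i) {m : ℝ} (hm0 : 0 ≤ m) (hm1 : m ≤ 1)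
    (hm : ∀ i, m ≤ 1 - x i) :
    F w - (1 - m) * F u ≤ F (x + hadamard (slack x) w) := by
  have e : x + hadamard (slack x) w = w + hadamard (slack w) x := by
    ext i
    simp only [PiLp.add_apply, hadamard_apply, slack_apply]
    ring
  have hd : ∀ i, 0 ≤ hadamard (slack w) x i := fun i =>
    mul_nonneg (sub_nonneg.2 (hw i).2) (hx i).1
  have hslack : ∀ i, 1 - (u + hadamard (slack w) x) i = (1 - x i) * (1 - u i) := fun i => by
    simp only [PiLp.add_apply, hadamard_apply, slack_apply, hxwu]
    ring
  have hud : u + hadamard (slack w) x ∈ cube n := fun i => by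
    refine ⟨add_nonneg (hu i).1 (hd i), sub_nonneg.1 ?_⟩
    rw [hslack]
    exact mul_nonneg (sub_nonneg.2 (hx i).2) (sub_nonneg.2 (hu i).2)
  have h1 := hDR.sub_le_sub hw hud hwu hd
  have h2 := hDR.mul_le_of_slack (y := u + hadamard (slack w) x) hF h0 hu
    (fun i => by simpa using hd i) hm0 hm1 (fun i => by
    rw [hslack]
    exact mul_le_mul_of_nonneg_right (hm i) (sub_nonneg.2 (hu i).2))
  rw [e]
  linarith

theorem add_restrict_slack_mem_cube {o : E n} (ho : o ∈ cube n) (A : Finset (Fin n)) :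
    o + restrict (slack o) A ∈ cube n := fun i => by
  have := ho i
  simp only [PiLp.add_apply, restrict_apply, slack_apply]
  split_ifs <;> constructor <;> linarith

/-- The guarantee for the last iterate of a single run. The point `o + restrict (slack o) A` is the
join of `o` with the indicator of `A`. -/
theorem IsRun.last_ge (hP : IsFeasibleDomain P) (h0 : ∀ z ∈ cube n, 0 ≤ F z)
    (hDR : IsDRSubmodular F) {L : ℝ} (hL : 0 ≤ L) (hF : IsLSmooth F L)
    {A : Finset (Fin n)} {N₁ N₂ : ℕ} {x : ℕ → E n} (hN : 0 < (N₁ : ℝ) + N₂)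
    (hx : IsRun F P A N₁ N₂ x) {o : E n} (ho : o ∈ P) {τ : ℝ}
    (hτ : τ = N₁ / ((N₁ : ℝ) + N₂)) :
    Real.exp (τ - 1) * ((2 - τ - Real.exp (-τ)) * F o
        - (1 - Real.exp (-τ)) * F (restrict o A)
        - (2 - τ - 2 * Real.exp (-τ)) * F (o + restrict (slack o) A))
      - sqDiam P * L * ((N₁ : ℝ) + N₂)⁻¹ ≤ F (x (N₁ + N₂)) := by
  have hoc := hP.subset_cube ho
  set h := ((N₁ : ℝ) + N₂)⁻¹ with hh
  set q := Real.exp (-h) with hq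
  set u := o + restrict (slack o) A with hu
  set w := restrict o Aᶜ with hw
  set η := sqDiam P * L * h ^ 2 with hη
  have hh0 : 0 < h := inv_pos.2 hN
  have hq0 : 0 ≤ q := (Real.exp_pos _).le
  have hq1 : q ≤ 1 := Real.exp_le_one_iff.2 (by linarith)
  have hqh : q * (1 + h) ≤ 1 := exp_neg_mul_one_add_le h
  have hη0 : 0 ≤ η := by
    have : 0 ≤ sqDiam P := sq_nonneg _
    positivity
  have huc : u ∈ cube n := add_restrict_slack_mem_cube hoc A
  have hwi : ∀ i, w i = if i ∈ A then 0 else o i := fun i => by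
    simp only [hw, restrict_apply, Finset.mem_compl]
    split_ifs <;> rfl
  have hui : ∀ i, u i = if i ∈ A then 1 else o i := fun i => by
    simp only [hu, PiLp.add_apply, restrict_apply, slack_apply]
    split_ifs <;> ring
  have hwo : ∀ i, 0 ≤ w i ∧ w i ≤ o i := fun i => by
    have := hoc i
    rw [hwi]
    split_ifs
    exacts [⟨le_rfl, this.1⟩, ⟨this.1, le_rfl⟩]
  have hou : ∀ i, o i ≤ u i := fun i => by
    rw [hui]
    split_ifs
    exacts [(hoc i).2, le_rfl]
  have hwP : w ∈ P := hP.downClosed o ho w hwo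
  have hwc := hP.subset_cube hwP
  have hu0 := h0 u huc
  -- Feasibility of the directions `(1 - x) ⊙ z` with `z ∈ P`.
  have hdir : ∀ z ∈ P, ∀ j ≤ N₁ + N₂, hadamard (slack (x j)) z ∈ P := fun z hz j hj =>
    hP.downClosed z hz _ fun i =>
      ⟨mul_nonneg (sub_nonneg.2 (hx.mem_cube hP j hj i).2) (hP.subset_cube hz i).1,
        mul_le_of_le_one_left (hP.subset_cube hz i).1
          (by rw [slack_apply]; linarith [(hx.mem_cube hP j hj i).1])⟩
  have hqj1 : ∀ j : ℕ, q ^ j ≤ 1 := fun j => pow_le_one₀ hq0 hq1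
  have hfirst := first_phase_recursion (f := fun j => F (x j)) (m := N₁) (a := F w) (b := F u)
    hq0 hq1 hqh hu0 hη0 (h0 _ (hx.mem_cube hP 0 (by omega))) (fun j hj => by
      have hxj := hx.mem_cube hP j (by omega)
      have h1 := hx.step_gain hP hDR hL hF (j := j) (by omega) (hdir w hwP j (by omega))
        (fun i => by
          rw [directionBound, hadamard_apply, slack_apply, hwi]
          by_cases hi : i ∈ A
          · simp [hi, hj]
          · simpa [hi] using mul_le_of_le_one_right (sub_nonneg.2 (hxj i).2) (hoc i).2)
      have h2 := hDR.sub_le_join hF.1 h0 hwc huc hxj (fun i => (hwo i).2.trans (hou i))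
        (fun i => by
          by_cases hi : i ∈ A
          · simp [hx.eq_zero_of_mem hP hi j hj.le]
          · simp [hwi, hui, hi])
        (pow_nonneg hq0 j) (hqj1 j) (fun i => hx.pow_le_slack hP (by omega) i)
      rw [stepSize_of_lt N₂ hj, ← hh, ← hq] at h1
      have h3 := mul_le_mul_of_nonneg_left h2 (sub_nonneg.2 hq1)
      linarith) N₁ le_rfl
  have hsecond := second_phase_recursion (f := fun k => F (x (N₁ + k))) (m := N₂)
    (K := F o - (1 - q ^ N₁) * F u) hq0 hq1 hqh hη0
    (fun k hk => h0 _ (hx.mem_cube hP _ (by omega))) (fun k hk => by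
      have hx1 := hx.mem_cube hP N₁ (by omega)
      have hxj := hx.mem_cube hP (N₁ + k) (by omega)
      have h1 := hx.step_gain hP hDR hL hF (j := N₁ + k) (by omega)
        (hdir o ho (N₁ + k) (by omega)) (fun i => by
          rw [directionBound, if_neg (by omega)]
          exact mul_le_of_le_one_right (sub_nonneg.2 (hxj i).2) (hoc i).2)
      have h2 := hDR.sub_le_join hF.1 h0 hoc huc hx1 hou
        (fun i => by
          by_cases hi : i ∈ A
          · simp [hx.eq_zero_of_mem hP hi N₁ le_rfl]
          · simp [hui, hi])
        (pow_nonneg hq0 N₁) (hqj1 N₁) (fun i => hx.pow_le_slack hP (by omega) i)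
      have hjoin : x N₁ + hadamard (slack (x N₁)) o ∈ cube n := fun i => by
        have a := hx1 i
        have b := hoc i
        simp only [PiLp.add_apply, hadamard_apply, slack_apply]
        constructor <;> nlinarith
      have h3 := hDR.mul_le_of_slack
        (y := x (N₁ + k) + hadamard (slack (x (N₁ + k))) o) hF.1 h0 hjoin
        (fun i => by
          have a := (hx.slack_le hP N₁ k (by omega) i).1
          have b := mul_le_mul_of_nonneg_right a (sub_nonneg.2 (hoc i).2)
          simp only [PiLp.add_apply, hadamard_apply, slack_apply]
          linarith) (pow_nonneg hq0 k) (hqj1 k)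
        (fun i => by
          have a := (hx.slack_le hP N₁ k (by omega) i).2
          have b := mul_le_mul_of_nonneg_right a (sub_nonneg.2 (hoc i).2)
          simp only [PiLp.add_apply, hadamard_apply, slack_apply]
          linarith)
      have h4 := h3.trans' (mul_le_mul_of_nonneg_left h2 (pow_nonneg hq0 k))
      rw [stepSize_of_le N₂ (by omega), ← hh, ← hq] at h1
      have h5 := mul_le_mul_of_nonneg_left h4 (mul_nonneg hq0 hh0.le)
      rw [← add_assoc]
      linarith) N₂ le_rfl
  -- Splitting `o` into its parts on `A` and off `A`.
  have hsplit : F o - F (restrict o A) ≤ F w := by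
    have e : w + restrict o A = o := by
      ext i
      simp only [PiLp.add_apply, hwi, restrict_apply]
      split_ifs <;> simp
    have hA : ∀ i, 0 ≤ restrict o A i ∧ restrict o A i ≤ o i := fun i => by
      have := hoc i
      rw [restrict_apply]
      split_ifs
      exacts [⟨this.1, le_rfl⟩, ⟨le_rfl, this.1⟩]
    have h1 := hDR.sub_le_sub (x := 0) (y := w) (d := restrict o A) (fun i => by simp)
      (by rwa [e]) (fun i => (hwo i).1) (fun i => (hA i).1)
    have h2 := h0 0 (fun i => by simp)
    rw [e, zero_add] at h1
    linarith
  have hNh : ((N₁ : ℝ) + N₂) * h = 1 := mul_inv_cancel₀ hN.ne'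
  have hτ1 : (N₁ : ℝ) * h = τ := by rw [hτ, hh, div_eq_mul_inv]
  have hτ2 : (N₂ : ℝ) * h = 1 - τ := by linarith
  have hQ1 : q ^ N₁ = Real.exp (-τ) := by
    rw [hq, ← Real.exp_nat_mul, ← hτ1]
    ring_nf
  have hQ2 : q ^ N₂ = Real.exp (τ - 1) := by
    rw [hq, ← Real.exp_nat_mul]
    congr 1
    linarith
  have hη1 : (N₁ : ℝ) * η + N₂ * η = sqDiam P * L * h := by
    rw [hη]
    linear_combination sqDiam P * L * h * hNh
  have hE : Real.exp (τ - 1) ≤ 1 := hQ2 ▸ hqj1 N₂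
  have hE0 := (Real.exp_pos (τ - 1)).le
  have hT : 0 ≤ 1 - Real.exp (-τ) := hQ1 ▸ sub_nonneg.2 (hqj1 N₁)
  simp only [add_zero, hτ1, hτ2, hQ1, hQ2] at hfirst hsecond
  have h1 := mul_le_mul_of_nonneg_left hfirst hE0
  have h2 := mul_le_mul_of_nonneg_left (mul_le_mul_of_nonneg_left hsplit hT) hE0
  have h3 : Real.exp (τ - 1) * (N₁ * η) ≤ N₁ * η :=
    mul_le_of_le_one_left (by positivity) hE
  linarith

end AidedFW

theorem mainTheorem2 :
    ∃ C : ℝ, 0 < C ∧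
      ∀ (n : ℕ) (F : AidedFW.E n → ℝ) (P : Set (AidedFW.E n)) (L ε θ : ℝ) (N₁ N₂ : ℕ)
        (y : AidedFW.E n) (x : Finset (Fin n) → ℕ → AidedFW.E n),
        AidedFW.IsFeasibleDomain P →
        (∀ z ∈ AidedFW.cube n, 0 ≤ F z) →
        AidedFW.IsDRSubmodular F →
        0 ≤ L → AidedFW.IsLSmooth F L →
        0 < ε →
        |θ - 0.372| ≤ 0.0005 →
        |(N₁ : ℝ) - θ * ((N₁ : ℝ) + N₂)| ≤ 1 →
        C * max 1 (AidedFW.sqDiam P * L / ε) ≤ (N₁ : ℝ) + N₂ →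
        AidedFW.IsStationaryWithGap F P ε y →
        (∀ A : Finset (Fin n), AidedFW.IsRun F P A N₁ N₂ (x A)) →
        |AidedFW.outProb θ - 0.77| ≤ 0.0005 ∧
        (∀ A : Finset (Fin n), x A (N₁ + N₂) ∈ P) ∧
        0.385 * AidedFW.optValue F P - ε <
          AidedFW.expectedOutput F (AidedFW.outProb θ) y (fun A => x A (N₁ + N₂)) := by
  -- `N ≥ 10 ^ 5` keeps `N₁ / N` within the numerical slack around `θ`, and `D L / N` far
  -- below `ε`.
  refine ⟨100000, by norm_num, ?_⟩
  intro n F P L ε θ N₁ N₂ y x hP h0 hDR hL hF hε hθ hN₁ hN hy hx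
  refine ⟨AidedFW.abs_outProb_sub_le hθ, fun A => (hx A).mem hP le_rfl, ?_⟩
  obtain ⟨o, ho, hopt, hmax⟩ := hP.exists_optValue hF.1
  have hoc := hP.subset_cube ho
  have hyc := hP.subset_cube hy.1
  have hNbig : 100000 ≤ (N₁ : ℝ) + N₂ := by
    have := le_max_left 1 (AidedFW.sqDiam P * L / ε)
    linarith
  have hNpos : 0 < (N₁ : ℝ) + N₂ := by linarith
  have hδ : AidedFW.sqDiam P * L * ((N₁ : ℝ) + N₂)⁻¹ ≤ 0.00001 * ε := by
    have h1 : 100000 * (AidedFW.sqDiam P * L / ε) ≤ (N₁ : ℝ) + N₂ := by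
      have := le_max_right 1 (AidedFW.sqDiam P * L / ε)
      linarith
    rw [← mul_div_assoc, div_le_iff₀ hε] at h1
    rw [← div_eq_mul_inv, div_le_iff₀ hNpos]
    linarith
  obtain ⟨τ, hτ⟩ : ∃ τ : ℝ, τ = N₁ / ((N₁ : ℝ) + N₂) := ⟨_, rfl⟩
  have hτθ : |τ - θ| ≤ 0.00001 := by
    have h1 : τ - θ = ((N₁ : ℝ) - θ * ((N₁ : ℝ) + N₂)) / ((N₁ : ℝ) + N₂) := by
      rw [hτ]; field_simp
    rw [h1, abs_div, abs_of_pos hNpos, div_le_iff₀ hNpos]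
    linarith
  have hw : ∀ A, 0 ≤ AidedFW.drawProb y A := AidedFW.drawProb_nonneg hyc
  have hw1 := AidedFW.sum_drawProb y
  -- The values at `o ⊙ 1_A` and at the join of `o` and `1_A`, on average over `A`.
  have hr : ∑ A, AidedFW.drawProb y A * F (AidedFW.restrict o A) ≤ F (AidedFW.hadamard o y) := by
    simpa using hDR.sum_drawProb_le hF.1 (b := 0) (d := o) (fun i => by simp) (by simpa using hoc)
      (fun i => (hoc i).1) hyc
  have hs := hDR.sum_drawProb_le hF.1 (b := o) (d := AidedFW.slack o) hoc
    (by simpa [AidedFW.restrict_univ] using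
      AidedFW.add_restrict_slack_mem_cube hoc Finset.univ)
    (fun i => sub_nonneg.2 (hoc i).2) hyc
  have hrP : AidedFW.hadamard o y ∈ P := hP.downClosed o ho _ fun i =>
    ⟨mul_nonneg (hoc i).1 (hyc i).1, mul_le_of_le_one_right (hoc i).1 (hyc i).2⟩
  have hlast := Finset.sum_le_sum fun A (_ : A ∈ Finset.univ) => mul_le_mul_of_nonneg_left
    ((hx A).last_ge hP h0 hDR hL hF hNpos ho hτ) (hw A)
  have hout : AidedFW.expectedOutput F (AidedFW.outProb θ) y (fun A => x A (N₁ + N₂)) =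
      AidedFW.outProb θ * ∑ A, AidedFW.drawProb y A * F (x A (N₁ + N₂))
        + (1 - AidedFW.outProb θ) * F y := by
    calc AidedFW.expectedOutput F (AidedFW.outProb θ) y (fun A => x A (N₁ + N₂))
        = AidedFW.outProb θ * ∑ A, AidedFW.drawProb y A * F (x A (N₁ + N₂))
          + (∑ A, AidedFW.drawProb y A) * ((1 - AidedFW.outProb θ) * F y) := by
          rw [AidedFW.expectedOutput, Finset.mul_sum, Finset.sum_mul, ← Finset.sum_add_distrib]
          exact Finset.sum_congr rfl fun A _ => by ring
      _ = _ := by rw [hw1, one_mul]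
  rw [hout, ← hopt]
  refine AidedFW.combine_bounds hθ hτθ hε (h0 _ (hP.subset_cube hrP)) (hmax _ hrP) hδ
    (hy.sub_le hP hDR hF.1 ho) (hy.add_sub_le hP hDR hF.1 ho) (le_trans ?_ hlast)
  set κ := Real.exp (τ - 1) with hκ
  set t := Real.exp (-τ) with ht
  have hsum : ∑ A, AidedFW.drawProb y A * (κ * ((2 - τ - t) * F o
        - (1 - t) * F (AidedFW.restrict o A)
        - (2 - τ - 2 * t) * F (o + AidedFW.restrict (AidedFW.slack o) A))
      - AidedFW.sqDiam P * L * ((N₁ : ℝ) + N₂)⁻¹) =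
      κ * ((2 - τ - t) * F o
        - (1 - t) * ∑ A, AidedFW.drawProb y A * F (AidedFW.restrict o A)
        - (2 - τ - 2 * t) *
          ∑ A, AidedFW.drawProb y A * F (o + AidedFW.restrict (AidedFW.slack o) A))
      - AidedFW.sqDiam P * L * ((N₁ : ℝ) + N₂)⁻¹ := by
    trans ∑ A, (AidedFW.drawProb y A *
          (κ * (2 - τ - t) * F o - AidedFW.sqDiam P * L * ((N₁ : ℝ) + N₂)⁻¹)
        - κ * (1 - t) * (AidedFW.drawProb y A * F (AidedFW.restrict o A))
        - κ * (2 - τ - 2 * t) *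
          (AidedFW.drawProb y A * F (o + AidedFW.restrict (AidedFW.slack o) A)))
    · exact Finset.sum_congr rfl fun A _ => by ring
    · rw [Finset.sum_sub_distrib, Finset.sum_sub_distrib, ← Finset.sum_mul, ← Finset.mul_sum,
        ← Finset.mul_sum, hw1]
      ring
  rw [hsum]
  have hτ0 : 0 ≤ τ := by rw [hτ]; positivity
  have ht1 : 0 ≤ 1 - t := sub_nonneg.2 (Real.exp_le_one_iff.2 (by linarith))
  obtain ⟨g1, _⟩ := AidedFW.gain_bounds (τ := τ) (by
    rw [abs_le] at *
    constructor <;> linarith [hθ.1, hθ.2, hτθ.1, hτθ.2])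
  have ht2 : 0 ≤ 2 - τ - 2 * t := by
    have h1 : t * Real.exp τ = 1 := by rw [ht, ← Real.exp_add]; simp
    have h2 := mul_le_mul_of_nonneg_left g1 (Real.exp_pos (-τ)).le
    rw [← ht, ← mul_assoc, h1] at h2
    have := (Real.exp_pos (-τ)).le
    linarith
  have h1 := mul_le_mul_of_nonneg_left hr ht1
  have h2 := mul_le_mul_of_nonneg_left hs ht2
  have h3 := mul_le_mul_of_nonneg_left (add_le_add h1 h2) (Real.exp_pos (τ - 1)).le
  linarith
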